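/- Let $(X,d)$ be a complete separable metric space and let $\mathsf E:X\to\mathbb R\cup\{+\infty\}$ be lower semicontinuous, with dense domain $D(\mathsf E)=\{\mathsf E<\infty\}$, and bounded from below on every $d$-bounded set. Assume that there is $\lambda\in\mathbb R$ such that every $x\in X$ is the starting point of an $\mathrm{EVI}_\lambda$-gradient flow of $\mathsf E$, i.e. there is a curve $(\gamma_t)_{t>0}$, locally absolutely continuous in $(0,\infty)$, with $\gamma_t\to x$ as $t\downarrow0$ and $$\tfrac12\tfrac{d}{dt}d^2(\gamma_t,z)+\tfrac\lambda2 d^2(\gamma_t,z)+\mathsf E(\gamma_t)\le \mathsf E(z)\qquad\forall z\in X,\ \text{a.e. }t>0.$$ Let $|\partial\mathsf E|(x)=\limsup_{z\to x}[\mathsf E(x)-\mathsf E(z)]^+/d(x,z)$ for $x\in D(\mathsf E)$ ($0$ if $x$ is isolated) and $|\partial \mathsf E|=+\infty$ outside $D(\mathsf E)$. Assume that $\sigma$ is a Hausdorff topology on $X$ such that every $d$-bounded sequence has a $\sigma$-converging subsequence and such that $d$ and $|\partial\mathsf E|$ are sequentially $\sigma$-lower semicontinuous. For $\gamma\in C([0,1],(X,d))$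 put $\mathcal A(\gamma)=\frac12\int_0^1|\dot\gamma_t|^2dt$ ($+\infty$ if $\gamma$ is not absolutely continuous; $|\dot\gamma_t|$ is the metric speed), $\mathcal I(\gamma)=\frac12\int_0^1|\partial\mathsf E|^2(\gamma_t)\,dt$, and $\mathcal A_\varepsilon=\mathcal A+\varepsilon^2\mathcal I$ for $\varepsilon\ge0$ (with $\mathcal A_0=\mathcal A$). Fix $x,y\in X$ and, for $\varepsilon\ge0$, let $C_\varepsilon(x,y)=\inf\{\mathcal A_\varepsilon(\gamma):\gamma\in C([0,1],X),\ \gamma_0=x,\ \gamma_1=y\}$ and let $\Lambda_\varepsilon(x,y)$ be the set of $\omega\in AC^2([0,1],X)$ (absolutely continuous curves with square integrable metric speed) with $\omega_0=x$, $\omega_1=y$ and $\mathcal A_\varepsilon(\omega)=C_\varepsilon(x,y)$. Assume that $\Lambda_\varepsilon(x,y)\neq\emptyset$ for some $\varepsilon>0$, and that there is $\omega^0\in\Lambda_0(x,y)$ with $\mathcal I(\omega^0)<\infty$. Then $C_\varepsilon(x,y)<\infty$ for all $\varepsilon\ge0$; the map $\varepsilon\mapsto C_\varepsilon(x,y)$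 is right differentiable at every $\varepsilon\ge0$, its right derivative vanishes at $\varepsilon=0$, and the right derivative is right continuous at every $\varepsilon\ge0$; moreover, as $\varepsilon\downarrow0$, $$C_\varepsilon(x,y)-C_0(x,y)=\varepsilon^2\inf_{\Lambda_0(x,y)}\mathcal I+o(\varepsilon^2).$$ Finally, let $\varepsilon_n>0$ with $\varepsilon_n\to0$ and $\omega^n\in\Lambda_{\varepsilon_n}(x,y)$. Then there is $\omega^*\in\Lambda_0(x,y)$ such that, up to a subsequence, $\omega^n_t\to\omega^*_t$ with respect to $\sigma$ for every $t\in[0,1]$, and $\mathcal I(\omega^*)=\min_{\Lambda_0(x,y)}\mathcal I$. Furthermore, every pointwise-in-time $\sigma$-limit of a subsequence of $(\omega^n)$ belongs to $\Lambda_0(x,y)$ and minimizes $\mathcal I$ over $\Lambda_0(x,y)$. -/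

import Mathlib

open Set Filter Topology MeasureTheory

open scoped ENNReal Asymptotics

noncomputable section

namespace MetricSchrodinger

variable {X : Type*} [MetricSpace X]

/-- The (descending) slope `|∂E|` of `E : X → ℝ ∪ {+∞}`, with values in `[0, ∞]`: it is `+∞` outside
the domain of `E`, and `limsup_{y → x, y ≠ x} [E x - E y]⁺ / d(x, y)` inside the domain.
`EReal.toENNReal` is the positive part. At an isolated point the filter `𝓝[≠] x` is trivial and
the `limsup` in `[0, ∞]` is `0`. -/
def descSlope (E : X → EReal) (x : X) : ℝ≥0∞ :=
  if E x = ⊤ then ⊤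
  else limsup (fun y => (E x - E y).toENNReal / edist x y) (𝓝[≠] x)

/-- Gradient flows of `E` in the `EVI_lam` sense: locally absolutely continuous curves on `(0, ∞)`
with `½ d/dt d²(γ_t, y) + (lam / 2) d²(γ_t, y) + E(γ_t) ≤ E(y)` for every `y` and a.e. `t > 0`.
(The function `t ↦ d²(γ_t, y)` is locally absolutely continuous, so its derivative exists a.e.) -/
structure IsEVIFlow (E : X → EReal) (lam : ℝ) (γ : ℝ → X) : Prop where
  locallyAC : ∀ a b : ℝ, 0 < a → a < b → AbsolutelyContinuousOnInterval γ a b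
  evi : ∀ y : X, ∀ᵐ t ∂(volume.restrict (Ioi (0 : ℝ))),
    ((1 / 2 * deriv (fun s => dist (γ s) y ^ 2) t + lam / 2 * dist (γ t) y ^ 2 : ℝ) : EReal)
      + E (γ t) ≤ E y

/-- The standing assumptions on the functional `E : X → ℝ ∪ {+∞}` (on a complete separable `X`). -/
structure IsEVIFunctional (E : X → EReal) : Prop where
  ne_bot : ∀ x, E x ≠ ⊥
  lsc : LowerSemicontinuous E
  dense_domain : Dense {x | E x < ⊤}
  bddBelow_of_bounded : ∀ B : Set X, Bornology.IsBounded B → ∃ c : ℝ, ∀ x ∈ B, (c : EReal) ≤ E x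
  exists_flow : ∃ lam : ℝ, ∀ x : X, ∃ γ : ℝ → X,
    IsEVIFlow E lam γ ∧ Tendsto γ (𝓝[>] 0) (𝓝 x)

/-- The auxiliary topology `σ` on `X`: it is Hausdorff, `d`-bounded sequences have `σ`-converging
subsequences, and both the distance (jointly) and the slope of `E` are sequentially `σ`-lower
semicontinuous. -/
structure IsAdmissibleTopology (E : X → EReal) (σ : TopologicalSpace X) : Prop where
  t2 : @T2Space X σ
  seqCompact : ∀ u : ℕ → X, Bornology.IsBounded (range u) →
    ∃ a : X, ∃ φ : ℕ → ℕ, StrictMono φ ∧ Tendsto (u ∘ φ) atTop (@nhds X σ a)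
  dist_lsc : ∀ (u v : ℕ → X) (a b : X),
    Tendsto u atTop (@nhds X σ a) → Tendsto v atTop (@nhds X σ b) →
      edist a b ≤ liminf (fun n => edist (u n) (v n)) atTop
  slope_lsc : ∀ (u : ℕ → X) (a : X), Tendsto u atTop (@nhds X σ a) →
    descSlope E a ≤ liminf (fun n => descSlope E (u n)) atTop

/-- Curves `γ ∈ C([0, 1], (X, d))` with `γ 0 = x` and `γ 1 = y`; continuity always refers to the
metric topology. -/
abbrev Curve (x y : X) : Type _ := Path x y

/-- The metric speed `lim_{s → t} d(c s, c t) / |s - t|`, written with a `limsup`; for an absolutely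
continuous curve the limit exists for a.e. `t`. -/
def metricSpeed (c : ℝ → X) (t : ℝ) : ℝ≥0∞ :=
  limsup (fun s => edist (c s) (c t) / edist s t) (𝓝[≠] t)

/-- `γ ∈ AC([0, 1], X)`. -/
def IsAC {x y : X} (γ : Curve x y) : Prop :=
  AbsolutelyContinuousOnInterval γ.extend 0 1

/-- `γ ∈ AC²([0, 1], X)`: absolutely continuous with square integrable metric speed. -/
def IsAC2 {x y : X} (γ : Curve x y) : Prop :=
  IsAC γ ∧ ∫⁻ t in Icc (0 : ℝ) 1, metricSpeed γ.extend t ^ 2 < ⊤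

open Classical in
/-- The kinetic energy `𝒜(γ) = ½ ∫₀¹ |γ'_t|² dt`, equal to `+∞` if `γ` is not absolutely
continuous. -/
def kinetic {x y : X} (γ : Curve x y) : ℝ≥0∞ :=
  if IsAC γ then 2⁻¹ * ∫⁻ t in Icc (0 : ℝ) 1, metricSpeed γ.extend t ^ 2 else ⊤

/-- The (halved) Fisher information `ℐ(γ) = ½ ∫₀¹ |∂E|²(γ_t) dt`. -/
def fisher (E : X → EReal) {x y : X} (γ : Curve x y) : ℝ≥0∞ :=
  2⁻¹ * ∫⁻ t in Icc (0 : ℝ) 1, descSlope E (γ.extend t) ^ 2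

/-- `𝒜_ε(γ) = 𝒜(γ) + ε² ℐ(γ)`, with `0 * ∞ = 0`, so that `𝒜_0 = 𝒜`. -/
def action (E : X → EReal) (ε : ℝ) {x y : X} (γ : Curve x y) : ℝ≥0∞ :=
  kinetic γ + ENNReal.ofReal (ε ^ 2) * fisher E γ

/-- The optimal entropic cost `C_ε(x, y)`. -/
def cost (E : X → EReal) (x y : X) (ε : ℝ) : ℝ≥0∞ :=
  ⨅ γ : Curve x y, action E ε γ

/-- The set `Λ_ε(x, y)` of `ε`-minimizers. -/
def minimizers (E : X → EReal) (x y : X) (ε : ℝ) : Set (Curve x y) :=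
  {ω | IsAC2 ω ∧ action E ε ω = cost E x y ε}

/-- `ω` belongs to `Λ_0(x, y)` and has the least Fisher information there. -/
def IsFisherMinimalGeodesic (E : X → EReal) {x y : X} (ω : Curve x y) : Prop :=
  ω ∈ minimizers E x y 0 ∧ ∀ ω' ∈ minimizers E x y 0, fisher E ω ≤ fisher E ω'

/-- Convergence of a sequence of curves in the pointwise-in-time `σ`-topology. -/
def TendstoPointwise (σ : TopologicalSpace X) (u : ℕ → unitInterval → X)
    (v : unitInterval → X) : Prop :=
  ∀ t : unitInterval, Tendsto (fun n => u n t) atTop (@nhds X σ (v t))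

end MetricSchrodinger

end

/-!
As a function of `s = ε²` the cost is the lower envelope of the affine functions
`s ↦ 𝒜(γ) + s ℐ(γ)`, hence concave on `[0, ∞)`. The competitor `ω₀ ∈ Λ_0` keeps it finite and
bounds its difference quotients at `0` by `ℐ(ω₀)`, so it is right differentiable with right
continuous derivative, also at `0`; substituting `s = ε²` gives the regularity in `ε` and the
expansion, with the right derivative `D` at `s = 0` as the coefficient of `ε²`.

Every `ω ∈ Λ_0` has `D ≤ ℐ(ω)`. Conversely, for `D' > D` almost minimizers `γ` at small `s`
satisfy `ℐ(γ) ≤ D'` and `𝒜(γ) ≤ C_0 + s D'`. Their kinetic energies are bounded, so they are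
equi-Hölder and converge pointwise in `σ` along a subsequence. The energy `𝒜` is lower
semicontinuous because a weak `L²` limit of the speeds dominates the increments of the limit
curve, and `ℐ` is lower semicontinuous by Fatou's lemma; the limit therefore lies in `Λ_0` and
has `ℐ ≤ D'`. The same compactness applies to minimizers at `ε_n → 0`.
-/

noncomputable section

namespace MetricSchrodinger

variable {X : Type*} [MetricSpace X]

/-! ### Metric speed -/

theorem sq_lintegral_le {α : Type*} [MeasurableSpace α] (μ : Measure α) {g : α → ℝ≥0∞}
    (hg : AEMeasurable g μ) : (∫⁻ a, g a ∂μ) ^ 2 ≤ μ univ * ∫⁻ a, g a ^ 2 ∂μ := by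
  have h := ENNReal.lintegral_mul_le_Lp_mul_Lq μ Real.HolderConjugate.two_two
    (aemeasurable_const (b := (1 : ℝ≥0∞))) hg
  simp only [Pi.mul_apply, one_mul, ENNReal.one_rpow, lintegral_const] at h
  refine (pow_le_pow_left₀ zero_le h 2).trans_eq ?_
  rw [mul_pow, ← ENNReal.rpow_natCast, ← ENNReal.rpow_natCast, ← ENNReal.rpow_mul,
    ← ENNReal.rpow_mul]
  norm_num

theorem lintegral_ne_top_of_sq {α : Type*} [MeasurableSpace α] {μ : Measure α} [IsFiniteMeasure μ]
    {g : α → ℝ≥0∞} (hg : AEMeasurable g μ) (h : ∫⁻ a, g a ^ 2 ∂μ ≠ ⊤) : ∫⁻ a, g a ∂μ ≠ ⊤ := by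
  have hsq := ne_top_of_le_ne_top (ENNReal.mul_ne_top (measure_ne_top μ univ) h)
    (sq_lintegral_le μ hg)
  simpa using hsq

theorem absolutelyContinuousOnInterval_of_dist_le {Y Z : Type*} [PseudoMetricSpace Y]
    [PseudoMetricSpace Z] {f : ℝ → Y} {g : ℝ → Z} {a b : ℝ}
    (hg : AbsolutelyContinuousOnInterval g a b)
    (h : ∀ s ∈ uIcc a b, ∀ t ∈ uIcc a b, dist (f s) (f t) ≤ dist (g s) (g t)) :
    AbsolutelyContinuousOnInterval f a b := by
  refine squeeze_zero' (.of_forall fun _ => Finset.sum_nonneg fun _ _ => dist_nonneg) ?_ hg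
  filter_upwards [mem_inf_of_right (mem_principal_self _)] with I hI
  exact Finset.sum_le_sum fun i hi => h _ (hI.1 i hi).1 _ (hI.1 i hi).2

theorem enorm_deriv_dist_le_metricSpeed {f : ℝ → X} {p : X} {t : ℝ}
    (h : DifferentiableAt ℝ (fun s => dist (f s) p) t) :
    ‖deriv (fun s => dist (f s) p) t‖ₑ ≤ metricSpeed f t := by
  rw [← h.hasDerivAt.tendsto_slope.enorm.limsup_eq]
  refine limsup_le_limsup ?_
  filter_upwards [self_mem_nhdsWithin] with s hs
  rw [slope_def_field, edist_dist, edist_dist, ← ENNReal.ofReal_div_of_pos (dist_pos.2 hs),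
    ← ofReal_norm, norm_div, Real.norm_eq_abs, Real.norm_eq_abs, Real.dist_eq s t]
  gcongr
  exact abs_dist_sub_le _ _ _

theorem edist_le_lintegral_metricSpeed {f : ℝ → X} {a b : ℝ} (hab : a ≤ b)
    (hf : AbsolutelyContinuousOnInterval f a b) :
    edist (f a) (f b) ≤ ∫⁻ r in Icc a b, metricSpeed f r := by
  have hac : AbsolutelyContinuousOnInterval (fun s => dist (f s) (f a)) a b :=
    absolutelyContinuousOnInterval_of_dist_le hf fun _ _ _ _ => abs_dist_sub_le _ _ _
  have hderiv : ∫ s in Ioc a b, deriv (fun s => dist (f s) (f a)) s = dist (f b) (f a) := by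
    rw [← intervalIntegral.integral_of_le hab, hac.integral_deriv_eq_sub, dist_self, sub_zero]
  calc edist (f a) (f b) = ‖dist (f b) (f a)‖ₑ := by
        rw [edist_comm, edist_dist, ← ofReal_norm, Real.norm_of_nonneg dist_nonneg]
    _ ≤ ∫⁻ s in Ioc a b, ‖deriv (fun s => dist (f s) (f a)) s‖ₑ := by
        rw [← hderiv]
        exact enorm_integral_le_lintegral_enorm _
    _ ≤ ∫⁻ r in Ioc a b, metricSpeed f r := by
        refine lintegral_mono_ae ?_
        filter_upwards [ae_restrict_of_ae hac.ae_differentiableAt,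
          ae_restrict_mem measurableSet_Ioc] with r hr hm
        exact enorm_deriv_dist_le_metricSpeed
          (hr (Ioc_subset_Icc_self.trans Icc_subset_uIcc hm))
    _ = ∫⁻ r in Icc a b, metricSpeed f r := by rw [restrict_Ioc_eq_restrict_Icc]

-- Displacements `h` instead of points `s = t + h`: for continuous `f` each supremum is then lower
-- semicontinuous in `t`.
theorem metricSpeed_eq_iInf_iSup (f : ℝ → X) (t : ℝ) :
    metricSpeed f t = ⨅ n : ℕ, ⨆ h : ℝ, ⨆ _ : h ≠ 0 ∧ |h| < ((n : ℝ) + 1)⁻¹,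
      edist (f (t + h)) (f t) / ENNReal.ofReal |h| := by
  have hb : (𝓝[≠] t).HasBasis (fun _ : ℕ => True)
      (fun n => {s | s ≠ t ∧ |s - t| < ((n : ℝ) + 1)⁻¹}) := by
    refine (nhdsWithin_hasBasis (Metric.nhds_basis_ball_inv_nat_succ (x := t)) {t}ᶜ).congr
      (fun _ => Iff.rfl) fun n _ => ?_
    ext s
    simp [Real.dist_eq, and_comm]
  rw [metricSpeed, hb.limsup_eq_iInf_iSup]
  simp only [iInf_true]
  refine iInf_congr fun n => ((Equiv.addLeft t).surjective.iSup_congr _ fun h => ?_).symm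
  simp [edist_dist (t + h) t]

theorem measurable_metricSpeed {f : ℝ → X} (hf : Continuous f) :
    Measurable (metricSpeed f) := by
  rw [funext (metricSpeed_eq_iInf_iSup f)]
  refine Measurable.iInf fun n => LowerSemicontinuous.measurable ?_
  refine lowerSemicontinuous_biSup fun h hh => Continuous.lowerSemicontinuous ?_
  exact (ENNReal.continuous_div_const _ (by simpa using hh.1)).comp (by fun_prop)

theorem ae_metricSpeed_le {f : ℝ → X} {a b : ℝ} {w : ℝ → ℝ≥0∞}
    (hw : AEMeasurable w (volume.restrict (Icc a b))) (hfin : ∫⁻ r in Icc a b, w r ≠ ⊤)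
    (h : ∀ s t, a ≤ s → s ≤ t → t ≤ b → edist (f s) (f t) ≤ ∫⁻ r in Icc s t, w r) :
    ∀ᵐ t ∂volume.restrict (Icc a b), metricSpeed f t ≤ w t := by
  have hind : ∀ {s t}, a ≤ s → t ≤ b →
      ∫⁻ r in Icc s t, (Icc a b).indicator w r = ∫⁻ r in Icc s t, w r := fun hs ht =>
    setLIntegral_congr_fun measurableSet_Icc fun _ hr =>
      indicator_of_mem (Icc_subset_Icc hs ht hr) _
  have hleb := (IsUnifLocDoublingMeasure.vitaliFamily (volume : Measure ℝ)
    1).ae_tendsto_lintegral_div ((aemeasurable_indicator_iff measurableSet_Icc).2 hw)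
      (by rwa [lintegral_indicator measurableSet_Icc])
  rw [← restrict_Ioo_eq_restrict_Icc]
  filter_upwards [ae_restrict_of_ae hleb, ae_restrict_mem measurableSet_Ioo] with t ht hmem
  rw [indicator_of_mem (Ioo_subset_Icc_self hmem)] at ht
  rw [metricSpeed, ← Iio_union_Ioi, nhdsWithin_union, limsup_sup_filter]
  refine sup_le ?_ ?_
  · rw [← (ht.comp (Real.tendsto_Icc_vitaliFamily_left t)).limsup_eq]
    refine limsup_le_limsup ?_
    filter_upwards [self_mem_nhdsWithin, Ioo_mem_nhdsLT hmem.1] with s hs hs'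
    simp only [Function.comp_apply, Real.volume_Icc, hind hs'.1.le hmem.2.le]
    rw [edist_dist s t, dist_comm s t, Real.dist_eq, abs_of_pos (sub_pos.2 hs)]
    gcongr
    exact h s t hs'.1.le hs'.2.le hmem.2.le
  · rw [← (ht.comp (Real.tendsto_Icc_vitaliFamily_right t)).limsup_eq]
    refine limsup_le_limsup ?_
    filter_upwards [self_mem_nhdsWithin, Ioo_mem_nhdsGT hmem.2] with s hs hs'
    simp only [Function.comp_apply, Real.volume_Icc, hind hmem.1.le hs'.2.le]
    rw [edist_dist s t, Real.dist_eq, abs_of_pos (sub_pos.2 hs), edist_comm]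
    gcongr
    exact h t s hmem.1.le hs'.1.le hs'.2.le

theorem absolutelyContinuousOnInterval_of_edist_le_lintegral {f : ℝ → X} {a b : ℝ} (hab : a ≤ b)
    {w : ℝ → ℝ≥0∞} (hw : AEMeasurable w (volume.restrict (Icc a b)))
    (hfin : ∫⁻ r in Icc a b, w r ≠ ⊤)
    (h : ∀ s t, a ≤ s → s ≤ t → t ≤ b → edist (f s) (f t) ≤ ∫⁻ r in Icc s t, w r) :
    AbsolutelyContinuousOnInterval f a b := by
  have hint : IntervalIntegrable (fun r => (w r).toReal) volume a b := by
    rw [intervalIntegrable_iff_integrableOn_Icc_of_le hab]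
    exact integrable_toReal_of_lintegral_ne_top hw hfin
  refine absolutelyContinuousOnInterval_of_dist_le
    (hint.absolutelyContinuousOnInterval_intervalIntegral left_mem_uIcc) ?_
  rw [uIcc_of_le hab]
  intro s hs t ht
  wlog hst : s ≤ t generalizing s t
  · rw [dist_comm, dist_comm (∫ _ in a..s, _)]
    exact this t ht s hs (le_of_not_ge hst)
  have hsub : Icc s t ⊆ Icc a b := Icc_subset_Icc hs.1 ht.2
  have hw' : AEMeasurable w (volume.restrict (Icc s t)) := hw.mono_set hsub
  have hfin' : ∫⁻ r in Icc s t, w r ≠ ⊤ := ne_top_of_le_ne_top hfin (lintegral_mono_set hsub)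
  have hprim : dist (∫ r in a..s, (w r).toReal) (∫ r in a..t, (w r).toReal)
      = (∫⁻ r in Icc s t, w r).toReal := by
    rw [dist_comm, Real.dist_eq, intervalIntegral.integral_interval_sub_left
      (hint.mono_set (uIcc_subset_uIcc left_mem_uIcc (Icc_subset_uIcc ht)))
      (hint.mono_set (uIcc_subset_uIcc left_mem_uIcc (Icc_subset_uIcc hs))),
      intervalIntegral.integral_of_le hst, ← integral_Icc_eq_integral_Ioc,
      integral_toReal hw' (ae_lt_top' hw' hfin'), abs_of_nonneg ENNReal.toReal_nonneg]
  rw [hprim, dist_edist]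
  exact ENNReal.toReal_mono hfin' (h s t hs.1 hst ht.2)

/-! ### Weak compactness in `L²` -/

theorem exists_tendsto_inner_of_norm_le {ι H : Type*} [NormedAddCommGroup H]
    [InnerProductSpace ℝ H] [CompleteSpace H] (𝒰 : Ultrafilter ι) {u : ι → H} {r : ℝ}
    (hu : ∀ i, ‖u i‖ ≤ r) :
    ∃ v : H, ‖v‖ ≤ r ∧ ∀ z, Tendsto (fun i => inner ℝ (u i) z) 𝒰 (𝓝 (inner ℝ v z)) := by
  let ℓ : ι → WeakDual ℝ H := fun i => StrongDual.toWeakDual (InnerProductSpace.toDual ℝ H (u i))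
  obtain ⟨φ, hφ, hlim⟩ := (WeakDual.isCompact_closedBall (𝕜 := ℝ) (E := H) 0 r).ultrafilter_le_nhds
    (𝒰.map ℓ) (by
      refine le_principal_iff.2 (Filter.mem_map.2 (univ_mem' fun i => ?_))
      simpa [ℓ] using hu i)
  refine ⟨(InnerProductSpace.toDual ℝ H).symm (WeakDual.toStrongDual φ), ?_, fun z => ?_⟩
  · simpa using hφ
  · have h := ((WeakDual.eval_continuous z).tendsto φ).comp hlim
    simpa [ℓ, Function.comp_def] using h

theorem enorm_toReal_rpow_two_le (a : ℝ≥0∞) : ‖a.toReal‖ₑ ^ (2 : ℝ) ≤ a ^ 2 := by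
  rw [ENNReal.rpow_two, ← ofReal_norm, Real.norm_of_nonneg ENNReal.toReal_nonneg]
  gcongr
  exact ENNReal.ofReal_toReal_le

theorem exists_lintegral_sq_le_of_liminf {α ι : Type*} [MeasurableSpace α] {μ : Measure α}
    (l : Filter ι) [l.NeBot] {g : ι → α → ℝ≥0∞} {C : ℝ≥0∞} (hC : C ≠ ⊤)
    (hg : ∀ i, AEMeasurable (g i) μ) (hgC : ∀ i, ∫⁻ a, g i a ^ 2 ∂μ ≤ C) :
    ∃ v : α → ℝ≥0∞, Measurable v ∧ ∫⁻ a, v a ^ 2 ∂μ ≤ C ∧ ∀ S, MeasurableSet S → μ S ≠ ⊤ →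
      liminf (fun i => ∫⁻ a in S, g i a ∂μ) l ≤ ∫⁻ a in S, v a ∂μ := by
  have hsm : ∀ i, AEStronglyMeasurable (fun a => (g i a).toReal) μ := fun i =>
    (hg i).ennreal_toReal.aestronglyMeasurable
  have hnorm : ∀ i, eLpNorm (fun a => (g i a).toReal) 2 μ ≤ C ^ (2⁻¹ : ℝ) := fun i => by
    rw [eLpNorm_eq_lintegral_rpow_enorm_toReal two_ne_zero ENNReal.ofNat_ne_top,
      ENNReal.toReal_ofNat, one_div]
    gcongr
    exact (lintegral_mono fun a => enorm_toReal_rpow_two_le _).trans (hgC i)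
  have hC' : C ^ (2⁻¹ : ℝ) ≠ ⊤ := ENNReal.rpow_ne_top_of_nonneg (by norm_num) hC
  have hmem : ∀ i, MemLp (fun a => (g i a).toReal) 2 μ := fun i =>
    ⟨hsm i, (hnorm i).trans_lt hC'.lt_top⟩
  obtain ⟨V, hV, hlim⟩ := exists_tendsto_inner_of_norm_le (Ultrafilter.of l)
    (u := fun i => (hmem i).toLp _) (r := (C ^ (2⁻¹ : ℝ)).toReal) fun i => by
      rw [Lp.norm_toLp]
      exact ENNReal.toReal_mono hC' (hnorm i)
  refine ⟨fun a => ‖V a‖ₑ, (Lp.stronglyMeasurable V).enorm, ?_, fun S hS hμS => ?_⟩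
  · have h : eLpNorm V 2 μ ≤ C ^ (2⁻¹ : ℝ) := by
      rwa [Lp.norm_def, ENNReal.toReal_le_toReal (Lp.eLpNorm_ne_top V) hC'] at hV
    rw [eLpNorm_eq_lintegral_rpow_enorm_toReal two_ne_zero ENNReal.ofNat_ne_top,
      ENNReal.toReal_ofNat, one_div] at h
    simpa [ENNReal.rpow_le_rpow_iff] using h
  have hset : ∀ i, ∫⁻ a in S, g i a ∂μ
      = ENNReal.ofReal (inner ℝ ((hmem i).toLp _) (indicatorConstLp 2 hS hμS (1 : ℝ))) := by
    intro i
    have : Fact (μ S < ⊤) := ⟨hμS.lt_top⟩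
    have hfin : ∫⁻ a in S, g i a ∂μ ≠ ⊤ := lintegral_ne_top_of_sq (hg i).restrict <|
      ne_top_of_le_ne_top hC ((setLIntegral_le_lintegral S _).trans (hgC i))
    rw [real_inner_comm, L2.inner_indicatorConstLp_one,
      setIntegral_congr_ae hS ((hmem i).coeFn_toLp.mono fun _ h _ => h),
      integral_toReal (hg i).restrict (ae_lt_top' (hg i).restrict hfin), ENNReal.ofReal_toReal hfin]
  calc liminf (fun i => ∫⁻ a in S, g i a ∂μ) l
      ≤ liminf (fun i => ∫⁻ a in S, g i a ∂μ) (Ultrafilter.of l) :=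
        liminf_le_liminf_of_le (Ultrafilter.of_le l)
    _ = ENNReal.ofReal (inner ℝ V (indicatorConstLp 2 hS hμS (1 : ℝ))) := by
        simp_rw [hset]
        exact (ENNReal.tendsto_ofReal (hlim _)).liminf_eq
    _ = ENNReal.ofReal (∫ a in S, V a ∂μ) := by
        rw [real_inner_comm, L2.inner_indicatorConstLp_one]
    _ ≤ ∫⁻ a in S, ‖V a‖ₑ ∂μ :=
        (Real.ofReal_le_enorm _).trans (enorm_integral_le_lintegral_enorm _)

/-! ### Kinetic energy -/

section Kinetic

variable {x y : X} {γ : Curve x y}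

theorem kinetic_of_isAC (h : IsAC γ) :
    kinetic γ = 2⁻¹ * ∫⁻ t in Icc (0 : ℝ) 1, metricSpeed γ.extend t ^ 2 :=
  if_pos h

theorem isAC_of_kinetic_ne_top (h : kinetic γ ≠ ⊤) : IsAC γ := by
  by_contra hc
  exact h (if_neg hc)

theorem lintegral_metricSpeed_sq (h : IsAC γ) :
    ∫⁻ t in Icc (0 : ℝ) 1, metricSpeed γ.extend t ^ 2 = 2 * kinetic γ := by
  rw [kinetic_of_isAC h, ← mul_assoc, ENNReal.mul_inv_cancel two_ne_zero ENNReal.ofNat_ne_top,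
    one_mul]

theorem isAC2_iff_kinetic_ne_top : IsAC2 γ ↔ kinetic γ ≠ ⊤ := by
  refine ⟨fun ⟨hac, hfin⟩ => ?_, fun h => ⟨isAC_of_kinetic_ne_top h, ?_⟩⟩
  · rw [kinetic_of_isAC hac]
    exact ENNReal.mul_ne_top (by simp) hfin.ne
  · rw [lintegral_metricSpeed_sq (isAC_of_kinetic_ne_top h)]
    exact (ENNReal.mul_ne_top ENNReal.ofNat_ne_top h).lt_top

theorem edist_extend_le_lintegral_metricSpeed (h : IsAC γ) {s t : ℝ} (hs : 0 ≤ s) (hst : s ≤ t)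
    (ht : t ≤ 1) :
    edist (γ.extend s) (γ.extend t) ≤ ∫⁻ r in Icc s t, metricSpeed γ.extend r := by
  refine edist_le_lintegral_metricSpeed hst (AbsolutelyContinuousOnInterval.mono h ?_)
  rw [uIcc_of_le hst, uIcc_of_le zero_le_one]
  exact Icc_subset_Icc hs ht

theorem kinetic_le_of_edist_le_lintegral {w : ℝ → ℝ≥0∞}
    (hw : AEMeasurable w (volume.restrict (Icc 0 1)))
    (h : ∀ s t, 0 ≤ s → s ≤ t → t ≤ 1 →
      edist (γ.extend s) (γ.extend t) ≤ ∫⁻ r in Icc s t, w r) :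
    kinetic γ ≤ 2⁻¹ * ∫⁻ t in Icc (0 : ℝ) 1, w t ^ 2 := by
  rcases eq_or_ne (∫⁻ t in Icc (0 : ℝ) 1, w t ^ 2) ⊤ with htop | htop
  · simp [htop]
  have hfin := lintegral_ne_top_of_sq hw htop
  rw [kinetic_of_isAC (absolutelyContinuousOnInterval_of_edist_le_lintegral zero_le_one hw hfin h)]
  gcongr 2⁻¹ * ?_
  refine lintegral_mono_ae ?_
  filter_upwards [ae_metricSpeed_le hw hfin h] with t ht
  gcongr

theorem edist_sq_le_kinetic (γ : Curve x y) (s t : unitInterval) :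
    edist (γ s) (γ t) ^ 2 ≤ edist s t * (2 * kinetic γ) := by
  wlog hst : s ≤ t generalizing s t
  · rw [edist_comm, edist_comm s]
    exact this t s (le_of_not_ge hst)
  rcases eq_or_ne (kinetic γ) ⊤ with htop | htop
  · rcases eq_or_ne s t with rfl | hne
    · simp
    · simp [htop, ENNReal.mul_top, hne]
  have hac := isAC_of_kinetic_ne_top htop
  have hlen : volume (Icc (s : ℝ) t) = edist s t := by
    rw [Real.volume_Icc, edist_comm, Subtype.edist_eq, edist_dist, Real.dist_eq,
      abs_of_nonneg (sub_nonneg.2 (show (s : ℝ) ≤ t from hst))]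
  calc edist (γ s) (γ t) ^ 2
      ≤ (∫⁻ r in Icc (s : ℝ) t, metricSpeed γ.extend r) ^ 2 := by
        gcongr
        simpa using edist_extend_le_lintegral_metricSpeed hac s.2.1 hst t.2.2
    _ ≤ edist s t * ∫⁻ r in Icc (s : ℝ) t, metricSpeed γ.extend r ^ 2 := by
        rw [← hlen, ← Measure.restrict_apply_univ]
        exact sq_lintegral_le _ (measurable_metricSpeed γ.continuous_extend).aemeasurable
    _ ≤ edist s t * (2 * kinetic γ) := by
        rw [← lintegral_metricSpeed_sq hac]
        gcongr
        exacts [s.2.1, t.2.2]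

theorem exists_strictMono_lt_of_liminf_lt {α : Type*} [CompleteLinearOrder α] {u : ℕ → α} {c : α}
    (h : liminf u atTop < c) : ∃ φ : ℕ → ℕ, StrictMono φ ∧ ∀ n, u (φ n) < c :=
  extraction_of_frequently_atTop (frequently_lt_of_liminf_lt isCobounded_ge_of_top h)

theorem liminf_le_liminf_comp {α : Type*} [CompleteLattice α] (u : ℕ → α) {φ : ℕ → ℕ}
    (hφ : Tendsto φ atTop atTop) : liminf u atTop ≤ liminf (u ∘ φ) atTop := by
  rw [liminf, liminf, ← Filter.map_map]
  exact liminf_le_liminf_of_le hφ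

theorem kinetic_le_liminf {γ : ℕ → Curve x y} {ω : Curve x y}
    (h : ∀ s t, edist (ω s) (ω t) ≤ liminf (fun n => edist (γ n s) (γ n t)) atTop) :
    kinetic ω ≤ liminf (fun n => kinetic (γ n)) atTop := by
  refine le_of_forall_gt_imp_ge_of_dense fun K hK => ?_
  rcases eq_or_ne K ⊤ with rfl | hKtop
  · exact le_top
  obtain ⟨φ, hφ, hφK⟩ := exists_strictMono_lt_of_liminf_lt hK
  have hac : ∀ n, IsAC (γ (φ n)) := fun n => isAC_of_kinetic_ne_top (hφK n).ne_top
  obtain ⟨w, hwm, hwK, hw⟩ := exists_lintegral_sq_le_of_liminf (μ := volume.restrict (Icc 0 1))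
    (g := fun n => metricSpeed (γ (φ n)).extend) atTop (C := 2 * K)
    (ENNReal.mul_ne_top ENNReal.ofNat_ne_top hKtop)
    (fun n => (measurable_metricSpeed (γ (φ n)).continuous_extend).aemeasurable) fun n => by
      rw [lintegral_metricSpeed_sq (hac n)]
      gcongr
      exact (hφK n).le
  have hdom : ∀ s t, 0 ≤ s → s ≤ t → t ≤ 1 →
      edist (ω.extend s) (ω.extend t) ≤ ∫⁻ r in Icc s t, w r := fun s t hs hst ht => by
    have hw' := hw (Icc s t) measurableSet_Icc (measure_ne_top _ _)
    simp only [Measure.restrict_restrict_of_subset (Icc_subset_Icc hs ht)] at hw'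
    calc edist (ω.extend s) (ω.extend t)
        ≤ liminf (fun n => edist ((γ n).extend s) ((γ n).extend t)) atTop := h _ _
      _ ≤ liminf (fun n => edist ((γ (φ n)).extend s) ((γ (φ n)).extend t)) atTop :=
          liminf_le_liminf_comp _ hφ.tendsto_atTop
      _ ≤ liminf (fun n => ∫⁻ r in Icc s t, metricSpeed (γ (φ n)).extend r) atTop :=
          liminf_le_liminf (.of_forall fun n =>
            edist_extend_le_lintegral_metricSpeed (hac n) hs hst ht)
      _ ≤ ∫⁻ r in Icc s t, w r := hw'
  calc kinetic ω ≤ 2⁻¹ * ∫⁻ t in Icc (0 : ℝ) 1, w t ^ 2 :=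
        kinetic_le_of_edist_le_lintegral hwm.aemeasurable hdom
    _ ≤ 2⁻¹ * (2 * K) := by gcongr
    _ = K := by rw [← mul_assoc, ENNReal.inv_mul_cancel two_ne_zero ENNReal.ofNat_ne_top, one_mul]

end Kinetic

/-! ### The auxiliary topology -/

namespace IsAdmissibleTopology

variable {E : X → EReal} {σ : TopologicalSpace X}

theorem edist_le_of_tendsto (hσ : IsAdmissibleTopology E σ) {u v : ℕ → X} {a b : X} {c : ℝ≥0∞}
    (hu : Tendsto u atTop (@nhds X σ a)) (hv : Tendsto v atTop (@nhds X σ b))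
    (h : ∀ n, edist (u n) (v n) ≤ c) : edist a b ≤ c :=
  (hσ.dist_lsc u v a b hu hv).trans (liminf_le_of_frequently_le' (.of_forall h))

theorem exists_tendsto_of_unique (hσ : IsAdmissibleTopology E σ) {u : ℕ → X}
    (hu : Bornology.IsBounded (range u))
    (huniq : ∀ (φ ψ : ℕ → ℕ) (a b : X), Tendsto φ atTop atTop → Tendsto ψ atTop atTop →
      Tendsto (u ∘ φ) atTop (@nhds X σ a) → Tendsto (u ∘ ψ) atTop (@nhds X σ b) → a = b) :
    ∃ a, Tendsto u atTop (@nhds X σ a) := by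
  obtain ⟨a, φ, hφ, ha⟩ := hσ.seqCompact u hu
  refine ⟨a, tendsto_of_subseq_tendsto fun ψ hψ => ?_⟩
  obtain ⟨b, θ, hθ, hb⟩ := hσ.seqCompact (u ∘ ψ) (hu.subset (range_comp_subset_range ψ u))
  rw [huniq φ (ψ ∘ θ) a b hφ.tendsto_atTop (hψ.comp hθ.tendsto_atTop) ha hb]
  exact ⟨θ, hb⟩

theorem tendsto_of_tendsto_edist (hσ : IsAdmissibleTopology E σ) {u : ℕ → X} {a : X}
    (hu : Tendsto (fun n => edist (u n) a) atTop (𝓝 0)) : Tendsto u atTop (@nhds X σ a) := by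
  have hlim : ∀ (φ : ℕ → ℕ) (b : X), Tendsto φ atTop atTop →
      Tendsto (u ∘ φ) atTop (@nhds X σ b) → b = a := fun φ b hφ hb => by
    have hle := hσ.dist_lsc _ (fun _ => a) b a hb tendsto_const_nhds
    exact edist_eq_zero.1 (le_antisymm (hle.trans_eq (hu.comp hφ).liminf_eq) zero_le)
  obtain ⟨b, hb⟩ := hσ.exists_tendsto_of_unique
    (Metric.isBounded_range_of_tendsto u (tendsto_iff_edist_tendsto_0.2 hu))
    fun φ ψ b c hφ hψ hb hc => (hlim φ b hφ hb).trans (hlim ψ c hψ hc).symm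
  rwa [hlim id b tendsto_id hb] at hb

end IsAdmissibleTopology

theorem measurable_of_le_liminf {Y : Type*} [TopologicalSpace Y] [SequentialSpace Y]
    [MeasurableSpace Y] [BorelSpace Y] {g : Y → ℝ≥0∞}
    (hg : ∀ (u : ℕ → Y) (a : Y), Tendsto u atTop (𝓝 a) → g a ≤ liminf (fun n => g (u n)) atTop) :
    Measurable g :=
  measurable_of_Iic fun _ => IsClosed.measurableSet <| IsSeqClosed.isClosed fun u a hu ha =>
    (hg u a ha).trans (liminf_le_of_frequently_le' (.of_forall hu))

theorem sq_liminf_eq (u : ℕ → ℝ≥0∞) :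
    liminf u atTop ^ 2 = liminf (fun n => u n ^ 2) atTop :=
  (pow_left_mono (M := ℝ≥0∞) 2).map_liminf_of_continuousAt u
    (ENNReal.continuous_pow 2).continuousAt

theorem fisher_le_liminf {E : X → EReal} {x y : X} {γ : ℕ → Curve x y} {ω : Curve x y}
    (hE : ∀ (u : ℕ → X) (a : X), Tendsto u atTop (𝓝 a) →
      descSlope E a ≤ liminf (fun n => descSlope E (u n)) atTop)
    (h : ∀ t, descSlope E (ω t) ≤ liminf (fun n => descSlope E (γ n t)) atTop) :
    fisher E ω ≤ liminf (fun n => fisher E (γ n)) atTop := by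
  borelize X
  have hmeas : ∀ n, Measurable fun t => descSlope E ((γ n).extend t) ^ 2 := fun n =>
    ((measurable_of_le_liminf hE).comp (γ n).continuous_extend.measurable).pow_const 2
  calc fisher E ω
      ≤ 2⁻¹ * ∫⁻ t in Icc (0 : ℝ) 1, liminf (fun n => descSlope E ((γ n).extend t) ^ 2) atTop := by
        unfold fisher
        gcongr with t
        rw [← sq_liminf_eq]
        gcongr
        exact h _
    _ ≤ 2⁻¹ * liminf (fun n => ∫⁻ t in Icc (0 : ℝ) 1, descSlope E ((γ n).extend t) ^ 2) atTop := by
        gcongr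
        exact lintegral_liminf_le hmeas
    _ = liminf (fun n => fisher E (γ n)) atTop :=
        (ENNReal.liminf_const_mul_of_ne_top (by simp)).symm

theorem IsAdmissibleTopology.fisher_le_liminf {E : X → EReal} {σ : TopologicalSpace X}
    (hσ : IsAdmissibleTopology E σ) {x y : X} {γ : ℕ → Curve x y} {ω : Curve x y}
    (h : TendstoPointwise σ (fun n => γ n) ω) :
    fisher E ω ≤ liminf (fun n => fisher E (γ n)) atTop :=
  MetricSchrodinger.fisher_le_liminf
    (fun u a hu =>
      hσ.slope_lsc u a (hσ.tendsto_of_tendsto_edist (tendsto_iff_edist_tendsto_0.1 hu)))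
    fun t => hσ.slope_lsc _ _ (h t)

/-! ### Compactness of sublevels of the kinetic energy -/

theorem tendsto_inf_principal_range {α : Type*} {θ : ℕ → ℕ} (hθ : StrictMono θ) {f : ℕ → α}
    {l : Filter α} (h : Tendsto (f ∘ θ) atTop l) : Tendsto f (atTop ⊓ 𝓟 (range θ)) l := by
  have hcomap : comap θ atTop = atTop :=
    comap_embedding_atTop (fun _ _ => hθ.le_iff_le) fun c => ⟨c, hθ.le_apply⟩
  rwa [← map_comap, hcomap, tendsto_map'_iff]

theorem exists_strictMono_forall_tendsto {Y : Type*} {τ : TopologicalSpace Y} {u : ℕ → ℕ → Y}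
    (h : ∀ k φ, StrictMono φ → ∃ a, ∃ ψ : ℕ → ℕ, StrictMono ψ ∧
      Tendsto (u k ∘ φ ∘ ψ) atTop (𝓝 a)) :
    ∃ φ : ℕ → ℕ, StrictMono φ ∧ ∀ k, ∃ a, Tendsto (u k ∘ φ) atTop (𝓝 a) := by
  have hstep : ∀ k (A : {A : Set ℕ // A.Infinite}), ∃ B : {B : Set ℕ // B.Infinite},
      B.1 ⊆ A.1 ∧ ∃ a, Tendsto (u k) (atTop ⊓ 𝓟 B.1) (𝓝 a) := by
    rintro k ⟨A, hA⟩
    obtain ⟨a, ψ, hψ, ha⟩ := h k (Nat.nth (· ∈ A)) (Nat.nth_strictMono hA)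
    have hmono := (Nat.nth_strictMono hA).comp hψ
    refine ⟨⟨range (Nat.nth (· ∈ A) ∘ ψ), infinite_range_of_injective hmono.injective⟩, ?_, a,
      tendsto_inf_principal_range hmono ha⟩
    rintro _ ⟨n, rfl⟩
    exact Nat.nth_mem_of_infinite hA _
  choose B hBA hB using hstep
  let A : ℕ → {A : Set ℕ // A.Infinite} := fun k => k.rec ⟨univ, infinite_univ⟩ B
  have hanti : Antitone fun k => (A k).1 := antitone_nat_of_succ_le fun k => hBA k (A k)
  obtain ⟨φ, hφ, hφA⟩ := extraction_forall_of_frequently (P := fun n m => m ∈ (A n).1) fun n =>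
    Nat.frequently_atTop_iff_infinite.2 (A n).2
  refine ⟨φ, hφ, fun k => ?_⟩
  obtain ⟨a, ha⟩ := hB k (A k)
  refine ⟨a, ha.comp (tendsto_inf.2 ⟨hφ.tendsto_atTop, tendsto_principal.2 ?_⟩)⟩
  filter_upwards [eventually_ge_atTop (k + 1)] with n hn
  exact hanti hn (hφA n)

theorem equicontinuous_of_edist_sq_le {ι T : Type*} [PseudoEMetricSpace T] {u : ι → T → X}
    {C : ℝ≥0∞} (hC : C ≠ ⊤) (h : ∀ i s t, edist (u i s) (u i t) ^ 2 ≤ edist s t * C) :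
    Equicontinuous u := by
  intro t U hU
  obtain ⟨ε, hε, hεU⟩ := mem_uniformity_edist.1 hU
  have hlim : Tendsto (fun s => edist t s * C) (𝓝 t) (𝓝 0) := by
    have hedist : Tendsto (fun s => edist t s) (𝓝 t) (𝓝 0) := by
      have hcont : Continuous fun s => edist t s := by fun_prop
      simpa using hcont.tendsto t
    simpa using ENNReal.Tendsto.mul_const hedist (.inr hC)
  filter_upwards [hlim.eventually_lt_const (ENNReal.pow_pos hε 2)] with s hs i
  exact hεU (lt_of_not_ge fun hge =>
    ((h i t s).trans_lt hs).not_ge (pow_le_pow_left₀ zero_le hge 2))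

theorem Curve.apply_zero {x y : X} (γ : Curve x y) : γ 0 = x := γ.source

theorem Curve.apply_one {x y : X} (γ : Curve x y) : γ 1 = y := γ.target

theorem exists_curve_of_edist_sq_le {x y : X} {v : unitInterval → X} {C : ℝ≥0∞} (hC : C ≠ ⊤)
    (h : ∀ s t, edist (v s) (v t) ^ 2 ≤ edist s t * C) (h0 : v 0 = x) (h1 : v 1 = y) :
    ∃ ω : Curve x y, ⇑ω = v :=
  ⟨⟨⟨v, (equicontinuous_of_edist_sq_le (u := fun _ : Unit => v) hC fun _ => h).continuous ()⟩,
    h0, h1⟩, rfl⟩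

namespace IsAdmissibleTopology

variable {E : X → EReal} {σ : TopologicalSpace X}

theorem exists_strictMono_forall_tendsto_of_equicontinuous (hσ : IsAdmissibleTopology E σ)
    {T : Type*} [TopologicalSpace T] [TopologicalSpace.SeparableSpace T] {u : ℕ → T → X}
    (hu : Equicontinuous u) (hbdd : ∀ t, Bornology.IsBounded (range fun n => u n t)) :
    ∃ φ : ℕ → ℕ, StrictMono φ ∧
      ∀ t, ∃ a, Tendsto (fun n => u (φ n) t) atTop (@nhds X σ a) := by
  rcases isEmpty_or_nonempty T with hT | hT
  · exact ⟨id, strictMono_id, isEmptyElim⟩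
  obtain ⟨q, hq⟩ := TopologicalSpace.exists_dense_seq T
  obtain ⟨φ, hφ, hφq⟩ := exists_strictMono_forall_tendsto (u := fun k n => u n (q k))
    fun k φ _ => hσ.seqCompact _ ((hbdd (q k)).subset (range_comp_subset_range φ _))
  choose p hp using hφq
  refine ⟨φ, hφ, fun t => hσ.exists_tendsto_of_unique
    ((hbdd t).subset (range_comp_subset_range φ fun n => u n t)) ?_⟩
  intro ψ θ a b hψ hθ ha hb
  refine eq_of_forall_dist_le fun ε hε => ?_
  obtain ⟨_, hk, k, rfl⟩ := mem_closure_iff_nhds.1 (hq t) _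
    (Metric.equicontinuousAt_iff_right.1 (hu t) (ε / 2) (half_pos hε))
  have hclose : ∀ n, edist (u n t) (u n (q k)) ≤ ENNReal.ofReal (ε / 2) := fun n => by
    rw [edist_dist]
    exact ENNReal.ofReal_le_ofReal (hk n).le
  have hap : edist a (p k) ≤ ENNReal.ofReal (ε / 2) :=
    hσ.edist_le_of_tendsto ha ((hp k).comp hψ) fun n => hclose _
  have hbp : edist b (p k) ≤ ENNReal.ofReal (ε / 2) :=
    hσ.edist_le_of_tendsto hb ((hp k).comp hθ) fun n => hclose _
  rw [edist_le_ofReal (half_pos hε).le] at hap hbp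
  linarith [dist_triangle_right a b (p k)]

theorem exists_curve_of_tendstoPointwise (hσ : IsAdmissibleTopology E σ) {x y : X}
    {γ : ℕ → Curve x y} (hfin : liminf (fun n => kinetic (γ n)) atTop ≠ ⊤) {v : unitInterval → X}
    (hv : TendstoPointwise σ (fun n => γ n) v) : ∃ ω : Curve x y, ⇑ω = v := by
  have hhol : ∀ s t, edist (v s) (v t) ^ 2
      ≤ edist s t * (2 * liminf (fun n => kinetic (γ n)) atTop) := fun s t =>
    calc edist (v s) (v t) ^ 2 ≤ liminf (fun n => edist (γ n s) (γ n t) ^ 2) atTop := by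
          rw [← sq_liminf_eq]
          gcongr
          exact hσ.dist_lsc _ _ _ _ (hv s) (hv t)
      _ ≤ liminf (fun n => edist s t * (2 * kinetic (γ n))) atTop :=
          liminf_le_liminf (.of_forall fun n => edist_sq_le_kinetic (γ n) s t)
      _ = edist s t * (2 * liminf (fun n => kinetic (γ n)) atTop) := by
          rw [ENNReal.liminf_const_mul_of_ne_top (edist_ne_top s t),
            ENNReal.liminf_const_mul_of_ne_top ENNReal.ofNat_ne_top]
  have hend : ∀ (t : unitInterval) (a : X), (∀ n, γ n t = a) → v t = a := fun t a ht =>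
    edist_eq_zero.1 <| le_antisymm (hσ.edist_le_of_tendsto (hv t) tendsto_const_nhds fun n => by
      simp only [ht n, edist_self, le_refl]) zero_le
  exact exists_curve_of_edist_sq_le (ENNReal.mul_ne_top ENNReal.ofNat_ne_top hfin) hhol
    (hend 0 x fun n => Curve.apply_zero (γ n)) (hend 1 y fun n => Curve.apply_one (γ n))

theorem exists_tendstoPointwise (hσ : IsAdmissibleTopology E σ) {x y : X} {γ : ℕ → Curve x y}
    (hfin : liminf (fun n => kinetic (γ n)) atTop ≠ ⊤) :
    ∃ φ : ℕ → ℕ, ∃ v : unitInterval → X, StrictMono φ ∧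
      TendstoPointwise σ (fun n => γ (φ n)) v := by
  obtain ⟨K, hK, hKtop⟩ := exists_between hfin.lt_top
  obtain ⟨θ, hθ, hθK⟩ := exists_strictMono_lt_of_liminf_lt hK
  have hC : 2 * K ≠ ⊤ := ENNReal.mul_ne_top ENNReal.ofNat_ne_top hKtop.ne
  have hhol : ∀ n s t, edist (γ (θ n) s) (γ (θ n) t) ^ 2 ≤ edist s t * (2 * K) := fun n s t => by
    refine (edist_sq_le_kinetic _ s t).trans ?_
    gcongr
    exact (hθK n).le
  have hbdd : ∀ t, Bornology.IsBounded (range fun n => γ (θ n) t) := fun t => by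
    refine (Metric.isBounded_closedBall (x := x) (r := √(edist t 0 * (2 * K)).toReal)).subset ?_
    rintro _ ⟨n, rfl⟩
    have h := ENNReal.toReal_mono (ENNReal.mul_ne_top (edist_ne_top t 0) hC) (hhol n t 0)
    rw [ENNReal.toReal_pow, ← dist_edist] at h
    simpa only [Metric.mem_closedBall, Curve.apply_zero] using Real.le_sqrt_of_sq_le h
  obtain ⟨φ, hφ, hlim⟩ := hσ.exists_strictMono_forall_tendsto_of_equicontinuous
    (equicontinuous_of_edist_sq_le hC hhol) hbdd
  choose v hv using hlim
  exact ⟨θ ∘ φ, v, hθ.comp hφ, hv⟩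

theorem kinetic_le_liminf (hσ : IsAdmissibleTopology E σ) {x y : X} {γ : ℕ → Curve x y}
    {ω : Curve x y} (h : TendstoPointwise σ (fun n => γ n) ω) :
    kinetic ω ≤ liminf (fun n => kinetic (γ n)) atTop :=
  MetricSchrodinger.kinetic_le_liminf fun s t => hσ.dist_lsc _ _ _ _ (h s) (h t)

end IsAdmissibleTopology

/-! ### Right derivatives of concave functions -/

section RightDerivative

variable {g : ℝ → ℝ} {a : ℝ}

theorem differentiableWithinAt_Ici_of_bddAbove_slope (hg : ConcaveOn ℝ (Ici a) g)
    (hbdd : BddAbove (slope g a '' Ioi a)) : DifferentiableWithinAt ℝ g (Ici a) a := by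
  have hanti : AntitoneOn (slope g a) (Ioi a) :=
    (hg.antitoneOn_slope_gt self_mem_Ici).mono fun t (ht : a < t) => ⟨ht.le, ht⟩
  refine HasDerivWithinAt.differentiableWithinAt (f' := sSup (slope g a '' Ioi a)) ?_
  rw [hasDerivWithinAt_iff_tendsto_slope, Ici_sdiff_left]
  exact hanti.tendsto_nhdsGT hbdd

theorem differentiableWithinAt_Ici_of_le (hg : ConcaveOn ℝ (Ici a) g)
    (ha : DifferentiableWithinAt ℝ g (Ici a) a) {s : ℝ} (hs : a ≤ s) :
    DifferentiableWithinAt ℝ g (Ici s) s := by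
  rcases hs.eq_or_lt with rfl | hs
  · exact ha
  · have hmem : s ∈ interior (Ici a) := by rwa [interior_Ici]
    rw [← differentiableWithinAt_Ioi_iff_Ici]
    simpa using (hg.neg.differentiableWithinAt_Ioi_of_mem_interior hmem).neg

theorem derivWithin_Ici_le_derivWithin_Ici (hg : ConcaveOn ℝ (Ici a) g)
    (ha : DifferentiableWithinAt ℝ g (Ici a) a) {s : ℝ} (hs : a < s) :
    derivWithin g (Ici s) s ≤ derivWithin g (Ici a) a := by
  have hslope := hasDerivWithinAt_iff_tendsto_slope.1
    (differentiableWithinAt_Ici_of_le hg ha hs.le).hasDerivWithinAt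
  rw [Ici_sdiff_left] at hslope
  refine (le_of_tendsto hslope ?_).trans (hg.slope_le_derivWithin self_mem_Ici hs.le hs ha)
  filter_upwards [self_mem_nhdsWithin] with t ht
  rw [slope_def_field, slope_def_field]
  exact hg.slope_anti_adjacent self_mem_Ici (hs.trans ht).le hs ht

theorem continuousWithinAt_derivWithin_Ici (hg : ConcaveOn ℝ (Ici a) g)
    (ha : DifferentiableWithinAt ℝ g (Ici a) a) :
    ContinuousWithinAt (fun r => derivWithin g (Ici r) r) (Ici a) a := by
  rw [← continuousWithinAt_Ioi_iff_Ici]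
  refine tendsto_order.2 ⟨fun l hl => ?_, fun u hu => ?_⟩
  · have hslope := hasDerivWithinAt_iff_tendsto_slope.1 ha.hasDerivWithinAt
    rw [Ici_sdiff_left] at hslope
    obtain ⟨t, hlt, hat⟩ :=
      ((hslope.eventually_const_lt hl).and self_mem_nhdsWithin).exists
    have hcont : ContinuousWithinAt (fun r => slope g r t) (Ioi a) a := by
      simp only [slope_def_field]
      exact (continuousWithinAt_const.sub
        (ha.continuousWithinAt.mono Ioi_subset_Ici_self)).div (by fun_prop) (sub_pos.2 hat).ne'
    filter_upwards [hcont.eventually_const_lt hlt, Ioo_mem_nhdsGT hat] with r hlr hr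
    have hgr : ConcaveOn ℝ (Ici r) g := hg.subset (Ici_subset_Ici.2 hr.1.le) (convex_Ici r)
    exact hlr.trans_le (hgr.slope_le_derivWithin self_mem_Ici hr.2.le hr.2
      (differentiableWithinAt_Ici_of_le hg ha hr.1.le))
  · filter_upwards [self_mem_nhdsWithin] with r hr
    exact (derivWithin_Ici_le_derivWithin_Ici hg ha hr).trans_lt hu

end RightDerivative

section CompSq

variable {g : ℝ → ℝ} {e : ℝ}

theorem hasDerivWithinAt_comp_sq (he : 0 ≤ e)
    (hg : DifferentiableWithinAt ℝ g (Ici (e ^ 2)) (e ^ 2)) :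
    HasDerivWithinAt (fun r => g (r ^ 2)) (derivWithin g (Ici (e ^ 2)) (e ^ 2) * (2 * e))
      (Ici e) e := by
  have hsq : HasDerivWithinAt (fun r : ℝ => r ^ 2) (2 * e) (Ici e) e := by
    simpa using (hasDerivAt_pow 2 e).hasDerivWithinAt
  exact hg.hasDerivWithinAt.comp (h := fun r : ℝ => r ^ 2) e hsq fun r hr =>
    pow_le_pow_left₀ he hr 2

theorem continuousWithinAt_derivWithin_comp_sq (he : 0 ≤ e)
    (hg : ∀ s, 0 ≤ s → DifferentiableWithinAt ℝ g (Ici s) s)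
    (hcont : ContinuousWithinAt (fun s => derivWithin g (Ici s) s) (Ici (e ^ 2)) (e ^ 2)) :
    ContinuousWithinAt (fun r => derivWithin (fun t => g (t ^ 2)) (Ici r) r) (Ici e) e := by
  have heq : ∀ r, 0 ≤ r → derivWithin (fun t => g (t ^ 2)) (Ici r) r
      = derivWithin g (Ici (r ^ 2)) (r ^ 2) * (2 * r) := fun r hr =>
    (hasDerivWithinAt_comp_sq hr (hg _ (sq_nonneg r))).derivWithin (uniqueDiffWithinAt_Ici r)
  refine ContinuousWithinAt.congr ?_ (fun r hr => heq r (he.trans hr)) (heq e he)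
  exact (hcont.comp (f := fun r : ℝ => r ^ 2) (by fun_prop)
    fun r hr => pow_le_pow_left₀ he hr 2).mul (by fun_prop)

theorem isLittleO_comp_sq (hg : DifferentiableWithinAt ℝ g (Ici 0) 0) :
    (fun r => g (r ^ 2) - g 0 - r ^ 2 * derivWithin g (Ici 0) 0) =o[𝓝[>] 0] fun r => r ^ 2 := by
  have hsq : Tendsto (fun r : ℝ => r ^ 2) (𝓝[>] 0) (𝓝[≥] 0) := by
    refine tendsto_nhdsWithin_iff.2 ⟨?_, .of_forall sq_nonneg⟩
    have hcont : Continuous fun r : ℝ => r ^ 2 := by fun_prop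
    simpa using (hcont.tendsto 0).mono_left nhdsWithin_le_nhds
  simpa [Function.comp_def] using hg.hasDerivWithinAt.isLittleO.comp_tendsto hsq

end CompSq

/-! ### Lower envelopes of affine functions -/

section Envelope

variable {ι : Type*} {A I : ι → ℝ≥0∞}

/-- The lower envelope of the family of affine functions `s ↦ A i + s * I i` on `[0, ∞]`, with
`0 * ∞ = 0`. It is the value function of minimizing `A` with penalty `I` of weight `s`. -/
def envelope (A I : ι → ℝ≥0∞) (s : ℝ≥0∞) : ℝ≥0∞ := ⨅ i, A i + s * I i

theorem envelope_le (i : ι) (s : ℝ≥0∞) : envelope A I s ≤ A i + s * I i := iInf_le _ i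

theorem envelope_zero_le (i : ι) : envelope A I 0 ≤ A i := by
  simpa using envelope_le (A := A) (I := I) i 0

theorem envelope_zero_le_envelope (s : ℝ≥0∞) : envelope A I 0 ≤ envelope A I s :=
  le_iInf fun i => (envelope_zero_le i).trans le_self_add

theorem le_and_le_of_add_mul_le_envelope_zero {i : ι} {s D : ℝ≥0∞} (h0 : envelope A I 0 ≠ ⊤)
    (hs0 : s ≠ 0) (hs : s ≠ ⊤) (h : A i + s * I i ≤ envelope A I 0 + s * D) :
    A i ≤ envelope A I 0 + s * D ∧ I i ≤ D := by
  refine ⟨le_self_add.trans h, ?_⟩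
  have hmul : envelope A I 0 + s * I i ≤ envelope A I 0 + s * D :=
    (add_le_add_left (envelope_zero_le i) _).trans h
  exact (ENNReal.mul_le_mul_iff_right hs0 hs).1 ((ENNReal.add_le_add_iff_left h0).1 hmul)

variable {i₀ : ι} (hA : A i₀ ≠ ⊤) (hI : I i₀ ≠ ⊤)
include hA hI

theorem envelope_ne_top {s : ℝ≥0∞} (hs : s ≠ ⊤) : envelope A I s ≠ ⊤ :=
  ne_top_of_le_ne_top (ENNReal.add_ne_top.2 ⟨hA, ENNReal.mul_ne_top hs hI⟩) (envelope_le i₀ s)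

theorem concaveOn_toReal_envelope :
    ConcaveOn ℝ (Ici 0) fun s : ℝ => (envelope A I (ENNReal.ofReal s)).toReal := by
  refine ⟨convex_Ici 0, fun s (hs : 0 ≤ s) t (ht : 0 ≤ t) a b ha hb hab => ?_⟩
  have hfin : ∀ r : ℝ, envelope A I (ENNReal.ofReal r) ≠ ⊤ := fun r =>
    envelope_ne_top hA hI ENNReal.ofReal_ne_top
  have hle : ENNReal.ofReal a * envelope A I (ENNReal.ofReal s)
      + ENNReal.ofReal b * envelope A I (ENNReal.ofReal t)
      ≤ envelope A I (ENNReal.ofReal (a * s + b * t)) := le_iInf fun i =>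
    calc ENNReal.ofReal a * envelope A I (ENNReal.ofReal s)
          + ENNReal.ofReal b * envelope A I (ENNReal.ofReal t)
        ≤ ENNReal.ofReal a * (A i + ENNReal.ofReal s * I i)
          + ENNReal.ofReal b * (A i + ENNReal.ofReal t * I i) := by
          gcongr <;> exact envelope_le i _
      _ = (ENNReal.ofReal a + ENNReal.ofReal b) * A i
          + (ENNReal.ofReal a * ENNReal.ofReal s + ENNReal.ofReal b * ENNReal.ofReal t) * I i := by
          ring
      _ = A i + ENNReal.ofReal (a * s + b * t) * I i := by
          rw [← ENNReal.ofReal_add ha hb, hab, ENNReal.ofReal_one, one_mul,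
            ← ENNReal.ofReal_mul ha, ← ENNReal.ofReal_mul hb,
            ← ENNReal.ofReal_add (by positivity) (by positivity)]
  have hreal := ENNReal.toReal_mono (hfin _) hle
  rw [ENNReal.toReal_add (ENNReal.mul_ne_top ENNReal.ofReal_ne_top (hfin s))
    (ENNReal.mul_ne_top ENNReal.ofReal_ne_top (hfin t)), ENNReal.toReal_mul,
    ENNReal.toReal_mul, ENNReal.toReal_ofReal ha, ENNReal.toReal_ofReal hb] at hreal
  exact hreal

theorem slope_toReal_envelope_nonneg {s : ℝ} (hs : 0 < s) :
    0 ≤ slope (fun r : ℝ => (envelope A I (ENNReal.ofReal r)).toReal) 0 s := by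
  have hle := ENNReal.toReal_mono (envelope_ne_top hA hI ENNReal.ofReal_ne_top)
    (envelope_zero_le_envelope (A := A) (I := I) (ENNReal.ofReal s))
  simpa only [slope_def_field, sub_zero, ENNReal.ofReal_zero] using
    div_nonneg (sub_nonneg.2 hle) hs.le

variable (hmin : A i₀ = envelope A I 0)
include hmin

theorem slope_toReal_envelope_le {s : ℝ} (hs : 0 < s) :
    slope (fun r : ℝ => (envelope A I (ENNReal.ofReal r)).toReal) 0 s ≤ (I i₀).toReal := by
  have hmul : ENNReal.ofReal s * I i₀ ≠ ⊤ := ENNReal.mul_ne_top ENNReal.ofReal_ne_top hI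
  have hle := ENNReal.toReal_mono (ENNReal.add_ne_top.2 ⟨hA, hmul⟩)
    (envelope_le (A := A) (I := I) i₀ (ENNReal.ofReal s))
  rw [ENNReal.toReal_add hA hmul, ENNReal.toReal_mul, ENNReal.toReal_ofReal hs.le, hmin] at hle
  rw [slope_def_field, sub_zero, div_le_iff₀ hs, ENNReal.ofReal_zero]
  linarith

theorem differentiableWithinAt_toReal_envelope :
    DifferentiableWithinAt ℝ (fun s : ℝ => (envelope A I (ENNReal.ofReal s)).toReal)
      (Ici 0) 0 := by
  refine differentiableWithinAt_Ici_of_bddAbove_slope (concaveOn_toReal_envelope hA hI)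
    ⟨(I i₀).toReal, ?_⟩
  rintro _ ⟨s, hs, rfl⟩
  exact slope_toReal_envelope_le hA hI hmin hs

theorem derivWithin_toReal_envelope_mem_Icc :
    derivWithin (fun s : ℝ => (envelope A I (ENNReal.ofReal s)).toReal) (Ici 0) 0
      ∈ Icc 0 (I i₀).toReal := by
  have hslope := hasDerivWithinAt_iff_tendsto_slope.1
    (differentiableWithinAt_toReal_envelope hA hI hmin).hasDerivWithinAt
  rw [Ici_sdiff_left] at hslope
  refine isClosed_Icc.mem_of_tendsto hslope ?_
  filter_upwards [self_mem_nhdsWithin] with s hs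
  exact ⟨slope_toReal_envelope_nonneg hA hI hs, slope_toReal_envelope_le hA hI hmin hs⟩

theorem envelope_le_add_mul_derivWithin {s : ℝ} (hs : 0 < s) :
    envelope A I (ENNReal.ofReal s) ≤ envelope A I 0 + ENNReal.ofReal s * ENNReal.ofReal
      (derivWithin (fun r : ℝ => (envelope A I (ENNReal.ofReal r)).toReal) (Ici 0) 0) := by
  have hslope := (concaveOn_toReal_envelope hA hI).slope_le_derivWithin self_mem_Ici hs.le hs
    (differentiableWithinAt_toReal_envelope hA hI hmin)
  have hD := (derivWithin_toReal_envelope_mem_Icc hA hI hmin).1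
  rw [slope_def_field, sub_zero, div_le_iff₀ hs, ENNReal.ofReal_zero, sub_le_iff_le_add'] at hslope
  rw [← ENNReal.ofReal_mul hs.le,
    ← ENNReal.ofReal_toReal (envelope_ne_top hA hI ENNReal.ofReal_ne_top),
    ← ENNReal.ofReal_toReal (envelope_ne_top hA hI ENNReal.zero_ne_top),
    ← ENNReal.ofReal_add ENNReal.toReal_nonneg (mul_nonneg hs.le hD)]
  exact ENNReal.ofReal_le_ofReal (by linarith)

end Envelope

/-! ### The small noise limit -/

/-- The optimal cost as a function of `s = ε²`: for fixed curves the action is affine in `s`, so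
that the cost is an `envelope`. -/
def costSq (E : X → EReal) (x y : X) : ℝ≥0∞ → ℝ≥0∞ :=
  envelope (fun γ : Curve x y => kinetic γ) fun γ => fisher E γ

theorem cost_eq_costSq (E : X → EReal) (x y : X) (ε : ℝ) :
    cost E x y ε = costSq E x y (ENNReal.ofReal (ε ^ 2)) := rfl

theorem mem_minimizers_zero_iff {E : X → EReal} {x y : X} {ω : Curve x y} :
    ω ∈ minimizers E x y 0 ↔ kinetic ω ≠ ⊤ ∧ kinetic ω = costSq E x y 0 := by
  simp [minimizers, isAC2_iff_kinetic_ne_top, action, cost_eq_costSq]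

theorem costSq_zero_ne_top {E : X → EReal} {x y : X} {ω : Curve x y}
    (hω : ω ∈ minimizers E x y 0) : costSq E x y 0 ≠ ⊤ :=
  (mem_minimizers_zero_iff.1 hω).2 ▸ (mem_minimizers_zero_iff.1 hω).1

theorem kinetic_le_and_fisher_le_of_mem_minimizers {E : X → EReal} {x y : X} {ε : ℝ}
    (hε : ε ≠ 0) {ω ω' : Curve x y} (hω : ω ∈ minimizers E x y ε)
    (hω' : ω' ∈ minimizers E x y 0) :
    kinetic ω ≤ costSq E x y 0 + ENNReal.ofReal (ε ^ 2) * fisher E ω' ∧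
      fisher E ω ≤ fisher E ω' := by
  refine le_and_le_of_add_mul_le_envelope_zero (costSq_zero_ne_top hω')
    (ENNReal.ofReal_pos.2 (by positivity)).ne' ENNReal.ofReal_ne_top ?_
  calc kinetic ω + ENNReal.ofReal (ε ^ 2) * fisher E ω
      ≤ kinetic ω' + ENNReal.ofReal (ε ^ 2) * fisher E ω' := hω.2.le.trans (envelope_le ω' _)
    _ = costSq E x y 0 + ENNReal.ofReal (ε ^ 2) * fisher E ω' := by
        rw [(mem_minimizers_zero_iff.1 hω').2]

theorem tendsto_kinetic_of_le {E : X → EReal} {x y : X} {γ : ℕ → Curve x y} {s : ℕ → ℝ≥0∞}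
    {D : ℝ≥0∞} (hD : D ≠ ⊤) (hs : Tendsto s atTop (𝓝 0))
    (h : ∀ n, kinetic (γ n) ≤ costSq E x y 0 + s n * D) :
    Tendsto (fun n => kinetic (γ n)) atTop (𝓝 (costSq E x y 0)) := by
  have hlim : Tendsto (fun n => costSq E x y 0 + s n * D) atTop (𝓝 (costSq E x y 0)) := by
    simpa using (ENNReal.Tendsto.mul_const hs (.inr hD)).const_add (costSq E x y 0)
  exact tendsto_of_tendsto_of_tendsto_of_le_of_le tendsto_const_nhds hlim
    (fun n => envelope_zero_le (γ n)) h

theorem tendsto_kinetic_of_mem_minimizers {E : X → EReal} {x y : X} {ω₀ : Curve x y}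
    (hω₀ : ω₀ ∈ minimizers E x y 0) (hfin : fisher E ω₀ ≠ ⊤) {ε : ℕ → ℝ} (hε : ∀ n, ε n ≠ 0)
    (hε0 : Tendsto ε atTop (𝓝 0)) {ω : ℕ → Curve x y} (hω : ∀ n, ω n ∈ minimizers E x y (ε n)) :
    Tendsto (fun n => kinetic (ω n)) atTop (𝓝 (costSq E x y 0)) := by
  have hsq : Tendsto (fun n => ENNReal.ofReal (ε n ^ 2)) atTop (𝓝 0) := by
    simpa using ENNReal.tendsto_ofReal (hε0.pow 2)
  exact tendsto_kinetic_of_le hfin hsq fun n =>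
    (kinetic_le_and_fisher_le_of_mem_minimizers (hε n) (hω n) hω₀).1

namespace IsAdmissibleTopology

variable {E : X → EReal} {σ : TopologicalSpace X} (hσ : IsAdmissibleTopology E σ) {x y : X}
include hσ

theorem exists_mem_minimizers_of_tendstoPointwise (h0 : costSq E x y 0 ≠ ⊤) {γ : ℕ → Curve x y}
    (hkin : Tendsto (fun n => kinetic (γ n)) atTop (𝓝 (costSq E x y 0)))
    {v : unitInterval → X} (hv : TendstoPointwise σ (fun n => γ n) v) :
    ∃ ω : Curve x y, ⇑ω = v ∧ ω ∈ minimizers E x y 0 ∧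
      fisher E ω ≤ liminf (fun n => fisher E (γ n)) atTop := by
  obtain ⟨ω, rfl⟩ := hσ.exists_curve_of_tendstoPointwise (by rwa [hkin.liminf_eq]) hv
  have hle : kinetic ω ≤ costSq E x y 0 := (hσ.kinetic_le_liminf hv).trans_eq hkin.liminf_eq
  exact ⟨ω, rfl, mem_minimizers_zero_iff.2 ⟨ne_top_of_le_ne_top h0 hle,
    hle.antisymm (envelope_zero_le ω)⟩, hσ.fisher_le_liminf hv⟩

theorem iInf_fisher_le (h0 : costSq E x y 0 ≠ ⊤) {D : ℝ≥0∞}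
    (hD : ∀ s : ℝ, 0 < s →
      costSq E x y (ENNReal.ofReal s) ≤ costSq E x y 0 + ENNReal.ofReal s * D) :
    ⨅ ω ∈ minimizers E x y 0, fisher E ω ≤ D := by
  refine le_of_forall_gt_imp_ge_of_dense fun D' hD' => ?_
  rcases eq_or_ne D' ⊤ with rfl | hD'top
  · exact le_top
  let s : ℕ → ℝ≥0∞ := fun n => ENNReal.ofReal (1 / ((n : ℝ) + 1))
  have hs : Tendsto s atTop (𝓝 0) := by
    simpa only [ENNReal.ofReal_zero] using
      ENNReal.tendsto_ofReal (tendsto_one_div_add_atTop_nhds_zero_nat (𝕜 := ℝ))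
  have hex : ∀ n, ∃ γ : Curve x y, kinetic γ ≤ costSq E x y 0 + s n * D' ∧ fisher E γ ≤ D' := by
    intro n
    have hpos : (0 : ℝ) < 1 / (n + 1) := by positivity
    have hs0 : s n ≠ 0 := (ENNReal.ofReal_pos.2 hpos).ne'
    have hlt : costSq E x y (s n) < costSq E x y 0 + s n * D' :=
      (hD _ hpos).trans_lt <|
        (ENNReal.add_lt_add_iff_left h0).2 (ENNReal.mul_lt_mul_right hs0 ENNReal.ofReal_ne_top hD')
    obtain ⟨γ, hγ⟩ := iInf_lt_iff.1 hlt
    exact ⟨γ, le_and_le_of_add_mul_le_envelope_zero h0 hs0 ENNReal.ofReal_ne_top hγ.le⟩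
  choose γ hkinetic hfisher using hex
  have hlim := tendsto_kinetic_of_le hD'top hs hkinetic
  obtain ⟨φ, v, hφ, hv⟩ := hσ.exists_tendstoPointwise (by rwa [hlim.liminf_eq])
  obtain ⟨ω, -, hω, hle⟩ :=
    hσ.exists_mem_minimizers_of_tendstoPointwise h0 (hlim.comp hφ.tendsto_atTop) hv
  exact (iInf₂_le ω hω).trans <|
    hle.trans (liminf_le_of_frequently_le' (.of_forall fun n => hfisher (φ n)))

variable {ω₀ : Curve x y} (hω₀ : ω₀ ∈ minimizers E x y 0) (hfin : fisher E ω₀ ≠ ⊤)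
include hω₀ hfin

theorem toReal_iInf_fisher_eq_derivWithin :
    (⨅ ω ∈ minimizers E x y 0, fisher E ω).toReal
      = derivWithin (fun s : ℝ => (costSq E x y (ENNReal.ofReal s)).toReal) (Ici 0) 0 := by
  have hmin := mem_minimizers_zero_iff.1 hω₀
  have hD := derivWithin_toReal_envelope_mem_Icc hmin.1 hfin hmin.2
  refine (ENNReal.toReal_eq_toReal_iff' ?_ ENNReal.ofReal_ne_top).2 ?_ |>.trans
    (ENNReal.toReal_ofReal hD.1)
  · exact ne_top_of_le_ne_top hfin (iInf₂_le ω₀ hω₀)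
  refine le_antisymm (hσ.iInf_fisher_le (costSq_zero_ne_top hω₀) fun s hs =>
    envelope_le_add_mul_derivWithin hmin.1 hfin hmin.2 hs) (le_iInf₂ fun ω hω => ?_)
  rcases eq_or_ne (fisher E ω) ⊤ with htop | htop
  · exact htop ▸ le_top
  have hmin' := mem_minimizers_zero_iff.1 hω
  exact ENNReal.ofReal_le_of_le_toReal
    (derivWithin_toReal_envelope_mem_Icc hmin'.1 htop hmin'.2).2

variable {ε : ℕ → ℝ} (hε : ∀ n, ε n ≠ 0) (hε0 : Tendsto ε atTop (𝓝 0))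
  {ω : ℕ → Curve x y} (hω : ∀ n, ω n ∈ minimizers E x y (ε n))
include hε hε0 hω

theorem exists_isFisherMinimalGeodesic_of_tendstoPointwise {v : unitInterval → X}
    (hv : TendstoPointwise σ (fun n => ω n) v) :
    ∃ ω' : Curve x y, ⇑ω' = v ∧ IsFisherMinimalGeodesic E ω' := by
  obtain ⟨ω', hω'v, hω', hle⟩ := hσ.exists_mem_minimizers_of_tendstoPointwise
    (costSq_zero_ne_top hω₀) (tendsto_kinetic_of_mem_minimizers hω₀ hfin hε hε0 hω) hv
  refine ⟨ω', hω'v, hω', fun ω'' hω'' => hle.trans ?_⟩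
  exact liminf_le_of_frequently_le' (.of_forall fun n =>
    (kinetic_le_and_fisher_le_of_mem_minimizers (hε n) (hω n) hω'').2)

theorem exists_strictMono_isFisherMinimalGeodesic :
    ∃ (φ : ℕ → ℕ) (ω' : Curve x y), StrictMono φ ∧
      TendstoPointwise σ (fun n => ω (φ n)) ω' ∧ IsFisherMinimalGeodesic E ω' := by
  obtain ⟨φ, v, hφ, hv⟩ := hσ.exists_tendstoPointwise (γ := ω) (by
    rw [(tendsto_kinetic_of_mem_minimizers hω₀ hfin hε hε0 hω).liminf_eq]
    exact costSq_zero_ne_top hω₀)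
  obtain ⟨ω', rfl, hω'⟩ := hσ.exists_isFisherMinimalGeodesic_of_tendstoPointwise hω₀ hfin
    (fun n => hε (φ n)) (hε0.comp hφ.tendsto_atTop) (fun n => hω (φ n)) hv
  exact ⟨φ, ω', hφ, hv, hω'⟩

end IsAdmissibleTopology

end MetricSchrodinger

end

open MetricSchrodinger in
theorem theorem5p6_general {X : Type*} [MetricSpace X] (E : X → EReal)
    (σ : TopologicalSpace X) (hσ : IsAdmissibleTopology E σ)
    (x y : X) (hfin : ∃ ω₀ ∈ minimizers E x y 0, fisher E ω₀ < ⊤) :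
    (∀ ε : ℝ, 0 ≤ ε → cost E x y ε < ⊤) ∧
    HasDerivWithinAt (fun ε => (cost E x y ε).toReal) 0 (Ici 0) 0 ∧
    (∀ ε : ℝ, 0 ≤ ε →
      DifferentiableWithinAt ℝ (fun s => (cost E x y s).toReal) (Ici ε) ε ∧
      ContinuousWithinAt
        (fun r => derivWithin (fun s => (cost E x y s).toReal) (Ici r) r) (Ici ε) ε) ∧
    ((fun ε : ℝ => (cost E x y ε).toReal - (cost E x y 0).toReal
        - ε ^ 2 * (⨅ ω ∈ minimizers E x y 0, fisher E ω).toReal)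
      =o[𝓝[>] 0] fun ε : ℝ => ε ^ 2) ∧
    (∀ (ε : ℕ → ℝ) (ω : ℕ → Curve x y), (∀ n, 0 < ε n) → Tendsto ε atTop (𝓝 0) →
      (∀ n, ω n ∈ minimizers E x y (ε n)) →
        (∃ (φ : ℕ → ℕ) (ω' : Curve x y), StrictMono φ ∧
          TendstoPointwise σ (fun n => ω (φ n)) ω' ∧ IsFisherMinimalGeodesic E ω') ∧
        (∀ (φ : ℕ → ℕ) (v : unitInterval → X), StrictMono φ →
          TendstoPointwise σ (fun n => ω (φ n)) v →
            ∃ ω' : Curve x y, ⇑ω' = v ∧ IsFisherMinimalGeodesic E ω')) := by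
  obtain ⟨ω₀, hω₀, hI⟩ := hfin
  have hmin := mem_minimizers_zero_iff.1 hω₀
  let g : ℝ → ℝ := fun s => (costSq E x y (ENNReal.ofReal s)).toReal
  have hg : ConcaveOn ℝ (Ici 0) g := concaveOn_toReal_envelope hmin.1 hI.ne
  have hg0 : DifferentiableWithinAt ℝ g (Ici 0) 0 :=
    differentiableWithinAt_toReal_envelope hmin.1 hI.ne hmin.2
  have hdiff := fun s (hs : 0 ≤ s) => differentiableWithinAt_Ici_of_le hg hg0 hs
  have hcont : ∀ s, 0 ≤ s → ContinuousWithinAt (fun r => derivWithin g (Ici r) r) (Ici s) s :=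
    fun s hs => continuousWithinAt_derivWithin_Ici
      (hg.subset (Ici_subset_Ici.2 hs) (convex_Ici s)) (hdiff s hs)
  refine ⟨fun ε _ => (envelope_ne_top hmin.1 hI.ne ENNReal.ofReal_ne_top).lt_top, ?_,
    fun ε hε => ⟨(hasDerivWithinAt_comp_sq hε (hdiff _ (sq_nonneg ε))).differentiableWithinAt,
      continuousWithinAt_derivWithin_comp_sq hε hdiff (hcont _ (sq_nonneg ε))⟩, ?_,
    fun ε ω hε hε0 hω => ⟨?_, fun φ v hφ hv => ?_⟩⟩
  · simpa [g, cost_eq_costSq] using hasDerivWithinAt_comp_sq le_rfl (hdiff _ (sq_nonneg 0))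
  · rw [hσ.toReal_iInf_fisher_eq_derivWithin hω₀ hI.ne]
    simpa [g, cost_eq_costSq] using isLittleO_comp_sq hg0
  · exact hσ.exists_strictMono_isFisherMinimalGeodesic hω₀ hI.ne (fun n => (hε n).ne') hε0 hω
  · exact hσ.exists_isFisherMinimalGeodesic_of_tendstoPointwise hω₀ hI.ne
      (fun n => (hε (φ n)).ne') (hε0.comp hφ.tendsto_atTop) (fun n => hω (φ n)) hv

open MetricSchrodinger in
theorem theorem5p6 {X : Type*} [MetricSpace X] [CompleteSpace X]
    [TopologicalSpace.SeparableSpace X]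
    (E : X → EReal) (hE : IsEVIFunctional E)
    (σ : TopologicalSpace X) (hσ : IsAdmissibleTopology E σ)
    (x y : X)
    (hsolv : ∃ ε : ℝ, 0 < ε ∧ (minimizers E x y ε).Nonempty)
    (hfin : ∃ ω₀ ∈ minimizers E x y 0, fisher E ω₀ < ⊤) :
    -- the cost is finite, so it may be regarded as a real function of `ε ≥ 0`
    (∀ ε : ℝ, 0 ≤ ε → cost E x y ε < ⊤) ∧
    -- it is right differentiable at `0` with right derivative `0`
    HasDerivWithinAt (fun ε => (cost E x y ε).toReal) 0 (Ici 0) 0 ∧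
    -- the right derivative exists and is right continuous at every `ε ≥ 0`
    (∀ ε : ℝ, 0 ≤ ε →
      DifferentiableWithinAt ℝ (fun s => (cost E x y s).toReal) (Ici ε) ε ∧
      ContinuousWithinAt
        (fun r => derivWithin (fun s => (cost E x y s).toReal) (Ici r) r) (Ici ε) ε) ∧
    -- second order expansion
    ((fun ε : ℝ => (cost E x y ε).toReal - (cost E x y 0).toReal
        - ε ^ 2 * (⨅ ω ∈ minimizers E x y 0, fisher E ω).toReal)
      =o[𝓝[>] 0] fun ε : ℝ => ε ^ 2) ∧
    -- sequences of minimizers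
    (∀ (ε : ℕ → ℝ) (ω : ℕ → Curve x y), (∀ n, 0 < ε n) → Tendsto ε atTop (𝓝 0) →
      (∀ n, ω n ∈ minimizers E x y (ε n)) →
        (∃ (φ : ℕ → ℕ) (ω' : Curve x y), StrictMono φ ∧
          TendstoPointwise σ (fun n => ω (φ n)) ω' ∧ IsFisherMinimalGeodesic E ω') ∧
        (∀ (φ : ℕ → ℕ) (v : unitInterval → X), StrictMono φ →
          TendstoPointwise σ (fun n => ω (φ n)) v →
            ∃ ω' : Curve x y, ⇑ω' = v ∧ IsFisherMinimalGeodesic E ω')) :=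
  theorem5p6_general E σ hσ x y hfin
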